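/- **Theorem (Gagliardo–Nirenberg inequality on bounded intervals).** Let $I=(a,b)\subset\mathbb{R}$ with $-\infty<a<b<\infty$, let $1\le p,q,r<\infty$, let $j,m\in\mathbb{N}_0$ with $j<m$, and let $\theta\in\mathbb{R}$ be such that $$\frac1p=j+\theta\Big(\frac1r-m\Big)+\frac{1-\theta}{q}\qquad\text{and}\qquad \frac jm\le\theta<1 .$$ Then there exists a constant $C=C(q,r,m,j,\theta,I)>0$ such that for all real-valued $u\in L^q(I)\cap W^{m,r}(I)$ the weak derivative $u^{(j)}$ belongs to $L^p(I)$ and $$\|u^{(j)}\|_{L^p(I)}\le C\Big(\|u^{(m)}\|_{L^r(I)}^{\theta}\,\|u\|_{L^q(I)}^{1-\theta}+\|u\|_{L^q(I)}\Big),$$ where $u^{(j)}$ and $u^{(m)}$ are the weak derivatives of $u$ on $I$, and $x^0=1$ for all $x\ge 0$ when $\theta=0$. -/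

import Mathlib

open MeasureTheory Set
open scoped ContDiff ENNReal

/-- `v` is a `k`-th weak derivative of `u` on the open set `Ω ⊆ ℝ`: both functions are locally
integrable on `Ω` and `∫_Ω u φ⁽ᵏ⁾ = (-1)ᵏ ∫_Ω v φ` for every test function `φ ∈ C_c^∞(Ω)`.
Only the values on `Ω` matter. -/
def HasWeakDerivOn (Ω : Set ℝ) (k : ℕ) (u v : ℝ → ℝ) : Prop :=
  LocallyIntegrableOn u Ω ∧ LocallyIntegrableOn v Ω ∧
    ∀ φ : ℝ → ℝ, ContDiff ℝ ∞ φ → HasCompactSupport φ → tsupport φ ⊆ Ω →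
      ∫ x in Ω, u x * iteratedDeriv k φ x = (-1 : ℝ) ^ k * ∫ x in Ω, v x * φ x

/-- `u` belongs to the Sobolev space `W^{m,r}(Ω)`: `u ∈ L^r(Ω)`, and for every `i ≤ m` the weak
derivative of order `i` of `u` on `Ω` exists and lies in `L^r(Ω)`. -/
def MemSobolev (Ω : Set ℝ) (m : ℕ) (r : ℝ≥0∞) (u : ℝ → ℝ) : Prop :=
  MemLp u r (volume.restrict Ω) ∧
    ∀ i ≤ m, ∃ v : ℝ → ℝ, HasWeakDerivOn Ω i u v ∧ MemLp v r (volume.restrict Ω)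

/-! On one interval of length `l`, Taylor expansion and the equivalence of norms on polynomials
bound the supremum of `u^(j)` by the `L¹` norms of `u^(m)` and `u`. Rescaling and Jensen's
inequality turn this into an `L^p` bound with two terms. By the scaling relation their powers of `l`
are `(1-θ)κ` and `-θκ`, with `κ = m - 1/r + 1/q` (`DerivChainOn.exists_integral_rpow_le`). On an
interval where the two terms agree, their sum is twice the product `‖u^(m)‖^θ ‖u‖^(1-θ)`
(`balanced_interpolation`).

The interval is therefore cut into balanced pieces, found by the intermediate value theorem
(`interpolation_of_subinterval_bounds`). The pieces sum up because `(x, y) ↦ x^α y^β` is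
superadditive when `α + β ≥ 1` (`rpow_mul_rpow_add_le`); with the scaling relation, that condition
is exactly `j/m ≤ θ`. If the whole interval is too short to balance, the `u` term dominates and
gives the additive `‖u‖`.

The argument runs on absolutely continuous representatives, supplied by the du Bois-Reymond lemma.
-/

/-! ### Polynomial norm equivalence and Jensen's inequality -/

/-- On the space of polynomials of degree less than `m`, the largest coefficient is controlled by
the `L¹` norm on the unit interval. -/
theorem exists_norm_coeff_le_integral_abs (m : ℕ) :
    ∃ C : ℝ, 0 < C ∧ ∀ c : Fin m → ℝ, ‖c‖ ≤ C * ∫ x in (0 : ℝ)..1, |∑ k, c k * x ^ (k : ℕ)| := by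
  rcases Nat.eq_zero_or_pos m with rfl | hm
  · exact ⟨1, one_pos, fun c => by simp [Subsingleton.elim c 0]⟩
  have : Nonempty (Fin m) := ⟨⟨0, hm⟩⟩
  set N : (Fin m → ℝ) → ℝ := fun c => ∫ x in (0 : ℝ)..1, |∑ k, c k * x ^ (k : ℕ)| with hN
  have hNcont : Continuous N := by
    apply intervalIntegral.continuous_parametric_intervalIntegral_of_continuous'
    fun_prop
  -- The minimum over the compact unit sphere is positive, as a polynomial vanishing on `(0, 1)` is
  -- zero; its reciprocal is the constant.
  obtain ⟨c₀, hc₀, hmin⟩ := (isCompact_sphere (0 : Fin m → ℝ) 1).exists_isMinOn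
    (NormedSpace.sphere_nonempty.2 zero_le_one) hNcont.continuousOn
  have hnn : ∀ c, 0 ≤ N c := fun c =>
    intervalIntegral.integral_nonneg zero_le_one fun x _ => abs_nonneg _
  have hpos : 0 < N c₀ := by
    refine lt_of_le_of_ne (hnn _) fun h0 => ?_
    have hz : ∀ x ∈ Ioo (0 : ℝ) 1, ∑ k, c₀ k * x ^ (k : ℕ) = 0 := by
      by_contra! hx
      obtain ⟨x, hx, hne⟩ := hx
      have : 0 < N c₀ := by
        refine intervalIntegral.integral_pos zero_lt_one ?_ (fun _ _ => abs_nonneg _)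
          ⟨x, Ioo_subset_Icc_self hx, abs_pos.2 hne⟩
        fun_prop
      exact this.ne h0
    set P : Polynomial ℝ := ∑ k : Fin m, Polynomial.C (c₀ k) * Polynomial.X ^ (k : ℕ) with hP
    have hP0 : P = 0 := by
      refine Polynomial.eq_zero_of_infinite_isRoot P
        ((Ioo_infinite (zero_lt_one (α := ℝ))).mono fun x hx => ?_)
      simp only [mem_ofPred_eq, Polynomial.IsRoot.def, hP, Polynomial.eval_finsetSum,
        Polynomial.eval_mul, Polynomial.eval_C, Polynomial.eval_pow, Polynomial.eval_X]
      exact hz x hx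
    have hc0 : c₀ = 0 := by
      ext k
      have := congrArg (fun Q => Polynomial.coeff Q (k : ℕ)) hP0
      simpa [hP, Polynomial.finsetSum_coeff, Polynomial.coeff_C_mul, Polynomial.coeff_X_pow,
        Fin.val_inj] using this
    simp [hc0] at hc₀
  refine ⟨(N c₀)⁻¹, inv_pos.2 hpos, fun c => ?_⟩
  rcases eq_or_ne c 0 with rfl | hc
  · simp
  have hcn : 0 < ‖c‖ := norm_pos_iff.2 hc
  have h1 : N c₀ ≤ N (‖c‖⁻¹ • c) := hmin (by simp [norm_smul, hcn.ne'])
  have h2 : N (‖c‖⁻¹ • c) = ‖c‖⁻¹ * N c := by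
    simp only [hN]
    rw [← intervalIntegral.integral_const_mul]
    refine intervalIntegral.integral_congr fun x _ => ?_
    simp only [Pi.smul_apply, smul_eq_mul, mul_assoc, ← Finset.mul_sum, abs_mul, abs_inv, abs_norm]
  rw [h2] at h1
  change ‖c‖ ≤ (N c₀)⁻¹ * N c
  rw [inv_mul_eq_div, le_div_iff₀ hpos]
  rw [inv_mul_eq_div, le_div_iff₀ hcn] at h1
  linarith

/-- Jensen's inequality for `x ↦ x ^ r` applied to the average of `|f|`. -/
theorem integral_abs_le_rpow_mul {f : ℝ → ℝ} {s t r : ℝ} (hst : s < t) (hr : 1 ≤ r)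
    (hf : IntervalIntegrable f volume s t)
    (hfr : IntervalIntegrable (fun x => |f x| ^ r) volume s t) :
    ∫ x in s..t, |f x| ≤ (t - s) ^ (1 - 1 / r) * (∫ x in s..t, |f x| ^ r) ^ (1 / r) := by
  have hl : 0 < t - s := sub_pos.2 hst
  have hr0 : 0 < r := by linarith
  have hI0 : 0 ≤ ∫ x in s..t, |f x| := intervalIntegral.integral_nonneg hst.le fun x _ =>
    abs_nonneg _
  have hJ0 : 0 ≤ ∫ x in s..t, |f x| ^ r := intervalIntegral.integral_nonneg hst.le fun x _ =>
    Real.rpow_nonneg (abs_nonneg _) _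
  have h1 := (convexOn_rpow hr).map_set_average_le (μ := volume) (t := Ioc s t)
    (f := fun x => |f x|) (continuousOn_id.rpow_const fun x _ => Or.inr hr0.le) isClosed_Ici
    (by simp [hst]) (by simp) (Filter.Eventually.of_forall fun x => mem_Ici.2 (abs_nonneg _))
    ((intervalIntegrable_iff_integrableOn_Ioc_of_le hst.le).1 hf.abs)
    ((intervalIntegrable_iff_integrableOn_Ioc_of_le hst.le).1 hfr)
  rw [setAverage_eq, setAverage_eq, ← intervalIntegral.integral_of_le hst.le,
    ← intervalIntegral.integral_of_le hst.le, Real.volume_real_Ioc_of_le hst.le, smul_eq_mul,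
    smul_eq_mul, Real.mul_rpow (inv_nonneg.2 hl.le) hI0] at h1
  have h2 := Real.rpow_le_rpow (by positivity) h1 (show 0 ≤ 1 / r by positivity)
  rw [← Real.mul_rpow (inv_nonneg.2 hl.le) hI0, ← Real.rpow_mul (by positivity),
    mul_one_div_cancel hr0.ne', Real.rpow_one, Real.mul_rpow (inv_nonneg.2 hl.le) hJ0,
    inv_mul_eq_div, div_le_iff₀ hl, Real.inv_rpow hl.le] at h2
  rw [Real.rpow_sub hl, Real.rpow_one]
  refine h2.trans (le_of_eq ?_)
  rw [div_eq_mul_inv]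
  ring

/-! ### Estimates for derivative chains on a single interval -/

/-- `g 0, …, g m` is a chain of iterated derivatives on `[s, t]`: each function is integrable and
each but the last is a primitive of the next. -/
structure DerivChainOn (m : ℕ) (g : ℕ → ℝ → ℝ) (s t : ℝ) : Prop where
  intervalIntegrable : ∀ i ≤ m, IntervalIntegrable (g i) volume s t
  sub_eq_integral : ∀ i < m, ∀ x ∈ Icc s t, ∀ y ∈ Icc s t, g i y - g i x = ∫ z in x..y, g (i + 1) z

namespace DerivChainOn

variable {m : ℕ} {g : ℕ → ℝ → ℝ} {s t : ℝ}

theorem mono (h : DerivChainOn m g s t) {s' t' : ℝ} (hs : s ≤ s') (hst : s' ≤ t') (ht : t' ≤ t) :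
    DerivChainOn m g s' t' where
  intervalIntegrable i hi := (h.intervalIntegrable i hi).mono_set (by
    rw [uIcc_of_le hst, uIcc_of_le (hs.trans (hst.trans ht))]
    exact Icc_subset_Icc hs ht)
  sub_eq_integral i hi x hx y hy := h.sub_eq_integral i hi x (Icc_subset_Icc hs ht hx) y
    (Icc_subset_Icc hs ht hy)

theorem continuousOn (h : DerivChainOn m g s t) (hst : s ≤ t) {i : ℕ} (hi : i < m) :
    ContinuousOn (g i) (Icc s t) := by
  have h1 : ContinuousOn (fun x => g i s + ∫ z in s..x, g (i + 1) z) (Icc s t) := by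
    have := intervalIntegral.continuousOn_primitive_interval'
      (h.intervalIntegrable (i + 1) hi) left_mem_uIcc
    rw [uIcc_of_le hst] at this
    exact continuousOn_const.add this
  refine h1.congr fun x hx => ?_
  have := h.sub_eq_integral i hi s (left_mem_Icc.2 hst) x hx
  dsimp only
  linarith

theorem comp_affine (h : DerivChainOn m g s t) (hst : s < t) :
    DerivChainOn m (fun i x => (t - s) ^ i * g i ((t - s) * x + s)) 0 1 where
  intervalIntegrable i hi := by
    have hl : t - s ≠ 0 := (sub_pos.2 hst).ne'
    have := (h.intervalIntegrable i hi).comp_add_right s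
    have := (this.comp_mul_left (c := t - s))
    simp only [sub_self, zero_div, div_self hl] at this
    exact this.const_mul _
  sub_eq_integral i hi x hx y hy := by
    have hl : 0 < t - s := sub_pos.2 hst
    have key : ∀ z ∈ Icc (0 : ℝ) 1, (t - s) * z + s ∈ Icc s t := fun z hz =>
      ⟨by nlinarith [hz.1], by nlinarith [hz.2]⟩
    have := h.sub_eq_integral i hi _ (key x hx) _ (key y hy)
    rw [intervalIntegral.integral_const_mul,
      intervalIntegral.integral_comp_mul_add (fun z => g (i + 1) z) hl.ne' s, ← this]
    simp only [smul_eq_mul]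
    field_simp
    ring

/-- The Taylor remainder of `g i` is the integral over `[0, x]` of that of `g (i + 1)`. Since `x ≤
1`, each integration preserves the bound, so no constant appears. -/
theorem abs_sub_taylor_le (h : DerivChainOn m g 0 1) (n : ℕ) :
    ∀ i, i + n + 1 = m → ∀ x ∈ Icc (0 : ℝ) 1,
      |g i x - ∑ k ∈ Finset.range (n + 1), g (i + k) 0 / k.factorial * x ^ k| ≤
        ∫ y in (0 : ℝ)..1, |g m y| := by
  have h0 : (0 : ℝ) ∈ Icc (0 : ℝ) 1 := by simp
  have hM : 0 ≤ ∫ y in (0 : ℝ)..1, |g m y| :=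
    intervalIntegral.integral_nonneg zero_le_one fun x _ => abs_nonneg _
  have hsub : ∀ i ≤ m, ∀ x ∈ Icc (0 : ℝ) 1, IntervalIntegrable (g i) volume 0 x := fun i hi x hx =>
    (h.mono le_rfl hx.1 hx.2).intervalIntegrable i hi
  induction n with
  | zero =>
    intro i hi x hx
    have him : i + 1 = m := by omega
    simp only [zero_add, Finset.sum_range_one, add_zero, Nat.factorial_zero, Nat.cast_one, div_one,
      pow_zero, mul_one]
    rw [h.sub_eq_integral i (by omega) 0 h0 x hx, him]
    refine (intervalIntegral.abs_integral_le_integral_abs hx.1).trans ?_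
    refine intervalIntegral.integral_mono_interval le_rfl hx.1 hx.2
      (Filter.Eventually.of_forall fun _ => abs_nonneg _) (h.intervalIntegrable m le_rfl).abs
  | succ n ih =>
    intro i hi x hx
    have hpoly : ∀ k, ∫ y in (0 : ℝ)..x, g (i + 1 + k) 0 / k.factorial * y ^ k =
        g (i + (k + 1)) 0 / (k + 1).factorial * x ^ (k + 1) := by
      intro k
      rw [intervalIntegral.integral_const_mul, integral_pow, Nat.factorial_succ,
        show i + 1 + k = i + (k + 1) by omega]
      push_cast
      field_simp
      simp
    have hI : IntervalIntegrable
        (fun y => ∑ k ∈ Finset.range (n + 1), g (i + 1 + k) 0 / k.factorial * y ^ k) volume 0 x :=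
      (Continuous.intervalIntegrable (by fun_prop) _ _)
    have key : g i x - ∑ k ∈ Finset.range (n + 1 + 1), g (i + k) 0 / k.factorial * x ^ k =
        ∫ y in (0 : ℝ)..x, (g (i + 1) y -
          ∑ k ∈ Finset.range (n + 1), g (i + 1 + k) 0 / k.factorial * y ^ k) := by
      rw [intervalIntegral.integral_sub (hsub _ (by omega) x hx) hI,
        ← h.sub_eq_integral i (by omega) 0 h0 x hx,
        intervalIntegral.integral_finsetSum fun k _ =>
          (Continuous.intervalIntegrable (by fun_prop) _ _),
        Finset.sum_congr rfl fun k _ => hpoly k, Finset.sum_range_succ' _ (n + 1)]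
      simp
      ring
    rw [key]
    have := intervalIntegral.norm_integral_le_of_norm_le_const (a := 0) (b := x)
      (C := ∫ y in (0 : ℝ)..1, |g m y|) (f := fun y => g (i + 1) y -
          ∑ k ∈ Finset.range (n + 1), g (i + 1 + k) 0 / k.factorial * y ^ k) (fun y hy => by
        rw [uIoc_of_le hx.1] at hy
        exact ih (i + 1) (by omega) y ⟨hy.1.le, hy.2.trans hx.2⟩)
    rw [Real.norm_eq_abs, sub_zero, abs_of_nonneg hx.1] at this
    exact this.trans (mul_le_of_le_one_right hM hx.2)

/-- The Taylor polynomial of `g 0` differs from `g 0` by at most `M`, so its `L¹` norm is at most `M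
+ U`. Norm equivalence then bounds every `g k 0` with `k < m`, and these are the coefficients in the
Taylor expansion of `g j`. -/
theorem exists_abs_le_unit (m : ℕ) : ∃ C : ℝ, 0 < C ∧ ∀ g : ℕ → ℝ → ℝ, DerivChainOn m g 0 1 →
    ∀ j < m, ∀ x ∈ Icc (0 : ℝ) 1,
      |g j x| ≤ C * ((∫ y in (0 : ℝ)..1, |g m y|) + ∫ y in (0 : ℝ)..1, |g 0 y|) := by
  obtain ⟨C, hC, hcoef⟩ := exists_norm_coeff_le_integral_abs m
  refine ⟨m * (m.factorial * C) + 1, by positivity, fun g h j hj x hx => ?_⟩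
  set M := ∫ y in (0 : ℝ)..1, |g m y| with hMdef
  set U := ∫ y in (0 : ℝ)..1, |g 0 y| with hUdef
  have hM : 0 ≤ M := intervalIntegral.integral_nonneg zero_le_one fun x _ => abs_nonneg _
  have hU : 0 ≤ U := intervalIntegral.integral_nonneg zero_le_one fun x _ => abs_nonneg _
  obtain ⟨n, rfl⟩ : ∃ n, m = n + 1 := ⟨m - 1, by omega⟩
  set c : Fin (n + 1) → ℝ := fun k => g k 0 / (k : ℕ).factorial with hc
  have hPsum : ∀ y : ℝ, ∑ k, c k * y ^ (k : ℕ) =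
      ∑ k ∈ Finset.range (n + 1), g (0 + k) 0 / k.factorial * y ^ k := fun y => by
    simp only [hc, zero_add]
    exact (Finset.sum_range (fun k => g k 0 / k.factorial * y ^ k)).symm
  have hP : ∫ y in (0 : ℝ)..1, |∑ k, c k * y ^ (k : ℕ)| ≤ M + U := by
    have h1 : ∀ y ∈ Icc (0 : ℝ) 1, |∑ k, c k * y ^ (k : ℕ)| ≤ M + |g 0 y| := fun y hy => by
      have := h.abs_sub_taylor_le n 0 (by omega) y hy
      rw [← hPsum, abs_sub_comm] at this
      calc |∑ k, c k * y ^ (k : ℕ)| = |(∑ k, c k * y ^ (k : ℕ) - g 0 y) + g 0 y| := by rw [sub_add_cancel]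
        _ ≤ _ := (abs_add_le _ _).trans (by gcongr)
    have h2 := intervalIntegral.integral_mono_on zero_le_one
      (Continuous.intervalIntegrable (by fun_prop) _ _)
      (intervalIntegrable_const.add (h.intervalIntegrable 0 (Nat.zero_le _)).abs) h1
    rw [intervalIntegral.integral_add intervalIntegrable_const
      (h.intervalIntegrable 0 (Nat.zero_le _)).abs] at h2
    simpa using h2
  have hcb : ∀ k ≤ n, |g k 0| ≤ (n + 1).factorial * C * (M + U) := fun k hk => by
    have h1 : |c ⟨k, by omega⟩| ≤ C * (M + U) :=
      (norm_le_pi_norm c ⟨k, by omega⟩).trans ((hcoef c).trans (by gcongr))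
    simp only [hc, abs_div, Nat.abs_cast] at h1
    rw [div_le_iff₀ (by positivity)] at h1
    calc |g k 0| ≤ C * (M + U) * k.factorial := h1
      _ ≤ C * (M + U) * (n + 1).factorial := by
        gcongr
        omega
      _ = _ := by ring
  have hT := h.abs_sub_taylor_le (n - j) j (by omega) x hx
  set S := ∑ k ∈ Finset.range (n - j + 1), g (j + k) 0 / k.factorial * x ^ k with hS
  have hSb : |S| ≤ (n + 1 : ℕ) * ((n + 1).factorial * C * (M + U)) := by
    have h1 : ∀ k ∈ Finset.range (n - j + 1), |g (j + k) 0 / k.factorial * x ^ k| ≤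
        (n + 1).factorial * C * (M + U) := fun k hk => by
      rw [Finset.mem_range] at hk
      rw [abs_mul, abs_div, Nat.abs_cast, abs_pow, abs_of_nonneg hx.1]
      have h3 : (1 : ℝ) ≤ k.factorial := by exact_mod_cast Nat.factorial_pos k
      calc |g (j + k) 0| / k.factorial * x ^ k ≤ |g (j + k) 0| * 1 :=
            mul_le_mul (div_le_self (abs_nonneg _) h3) (pow_le_one₀ hx.1 hx.2)
              (pow_nonneg hx.1 _) (abs_nonneg _)
        _ ≤ _ := by rw [mul_one]; exact hcb _ (by omega)
    refine (Finset.abs_sum_le_sum_abs _ _).trans ((Finset.sum_le_sum h1).trans ?_)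
    rw [Finset.sum_const, Finset.card_range, nsmul_eq_mul]
    gcongr
    omega
  calc |g j x| = |(g j x - S) + S| := by rw [sub_add_cancel]
    _ ≤ M + (n + 1 : ℕ) * ((n + 1).factorial * C * (M + U)) := (abs_add_le _ _).trans (by gcongr)
    _ ≤ (M + U) + (n + 1 : ℕ) * ((n + 1).factorial * C * (M + U)) := by gcongr; linarith
    _ = _ := by ring

/-- Affine rescaling of the unit interval; the constant does not depend on the interval. -/
theorem exists_abs_le (m : ℕ) : ∃ C : ℝ, 0 < C ∧ ∀ (g : ℕ → ℝ → ℝ) (s t : ℝ), s < t →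
    DerivChainOn m g s t → ∀ j < m, ∀ x ∈ Icc s t,
      |g j x| ≤ C * ((t - s) ^ ((m : ℝ) - j - 1) * (∫ y in s..t, |g m y|) +
        (t - s) ^ (-(j : ℝ) - 1) * ∫ y in s..t, |g 0 y|) := by
  obtain ⟨C, hC, hunit⟩ := exists_abs_le_unit m
  refine ⟨C, hC, fun g s t hst h j hj x hx => ?_⟩
  have hl : 0 < t - s := sub_pos.2 hst
  have h1 := hunit _ (h.comp_affine hst) j hj ((x - s) / (t - s))
    ⟨div_nonneg (by linarith [hx.1]) hl.le, (div_le_one hl).2 (by linarith [hx.2])⟩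
  have h2 : (t - s) * ((x - s) / (t - s)) + s = x := by field_simp; ring
  have h3 : ∀ i, ∫ y in (0 : ℝ)..1, |(t - s) ^ i * g i ((t - s) * y + s)| =
      (t - s) ^ ((i : ℝ) - 1) * ∫ y in s..t, |g i y| := fun i => by
    simp only [abs_mul, abs_pow, abs_of_pos hl]
    rw [intervalIntegral.integral_const_mul,
      intervalIntegral.integral_comp_mul_add (fun z => |g i z|) hl.ne' s, Real.rpow_sub hl,
      Real.rpow_natCast, Real.rpow_one, smul_eq_mul]
    simp only [mul_zero, zero_add, mul_one, sub_add_cancel]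
    ring
  simp only [h2, h3] at h1
  rw [abs_mul, abs_pow, abs_of_pos hl] at h1
  have h4 : (0 : ℝ) < (t - s) ^ j := pow_pos hl j
  rw [← le_div_iff₀' h4] at h1
  refine h1.trans (le_of_eq ?_)
  rw [Nat.cast_zero, sub_sub, add_comm (j : ℝ) 1, ← sub_sub, Real.rpow_sub hl ((m : ℝ) - 1),
    show -(j : ℝ) - 1 = (0 - 1) - j by ring, Real.rpow_sub hl (0 - 1), Real.rpow_natCast]
  field_simp

theorem exists_integral_rpow_le (m : ℕ) : ∃ C : ℝ, 0 < C ∧ ∀ (g : ℕ → ℝ → ℝ) (s t : ℝ), s < t →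
    DerivChainOn m g s t → ∀ j < m, ∀ p q r : ℝ, 1 ≤ p → 1 ≤ q → 1 ≤ r →
      IntervalIntegrable (fun x => |g 0 x| ^ q) volume s t →
      IntervalIntegrable (fun x => |g m x| ^ r) volume s t →
      ∫ x in s..t, |g j x| ^ p ≤
        (C * ((t - s) ^ ((m : ℝ) - j - 1 / r + 1 / p) * (∫ x in s..t, |g m x| ^ r) ^ (1 / r) +
          (t - s) ^ (-(j : ℝ) - 1 / q + 1 / p) * (∫ x in s..t, |g 0 x| ^ q) ^ (1 / q))) ^ p := by
  obtain ⟨C, hC, hsup⟩ := exists_abs_le m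
  refine ⟨C, hC, fun g s t hst h j hj p q r hp hq hr hiq hir => ?_⟩
  have hl : 0 < t - s := sub_pos.2 hst
  have hp0 : 0 < p := by linarith
  set A := (∫ x in s..t, |g m x| ^ r) ^ (1 / r) with hA
  set B := (∫ x in s..t, |g 0 x| ^ q) ^ (1 / q) with hB
  have hA0 : 0 ≤ A := Real.rpow_nonneg (intervalIntegral.integral_nonneg hst.le fun x _ =>
    Real.rpow_nonneg (abs_nonneg _) _) _
  have hB0 : 0 ≤ B := Real.rpow_nonneg (intervalIntegral.integral_nonneg hst.le fun x _ =>
    Real.rpow_nonneg (abs_nonneg _) _) _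
  -- `S` bounds `|g j|` uniformly; integrating its `p`-th power contributes the remaining factor `(t
  -- - s) ^ (1 / p)`.
  set S := C * ((t - s) ^ ((m : ℝ) - j - 1 / r) * A + (t - s) ^ (-(j : ℝ) - 1 / q) * B) with hS
  have hS0 : 0 ≤ S := by positivity
  have hpt : ∀ x ∈ Icc s t, |g j x| ^ p ≤ S ^ p := fun x hx => by
    refine Real.rpow_le_rpow (abs_nonneg _) ((hsup g s t hst h j hj x hx).trans ?_) hp0.le
    have h1 := integral_abs_le_rpow_mul hst hr (h.intervalIntegrable m le_rfl) hir
    have h2 := integral_abs_le_rpow_mul hst hq (h.intervalIntegrable 0 (Nat.zero_le _)) hiq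
    have e1 : (t - s) ^ ((m : ℝ) - j - 1 / r) =
        (t - s) ^ ((m : ℝ) - j - 1) * (t - s) ^ (1 - 1 / r) := by
      rw [← Real.rpow_add hl]
      ring_nf
    have e2 : (t - s) ^ (-(j : ℝ) - 1 / q) =
        (t - s) ^ (-(j : ℝ) - 1) * (t - s) ^ (1 - 1 / q) := by
      rw [← Real.rpow_add hl]
      ring_nf
    rw [hS, e1, e2, mul_assoc, mul_assoc]
    gcongr
  have hcont : IntervalIntegrable (fun x => |g j x| ^ p) volume s t := by
    apply ContinuousOn.intervalIntegrable
    rw [uIcc_of_le hst.le]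
    exact (h.continuousOn hst.le hj).abs.rpow_const fun x _ => Or.inr hp0.le
  have h1 := intervalIntegral.integral_mono_on hst.le hcont intervalIntegrable_const hpt
  rw [intervalIntegral.integral_const, smul_eq_mul] at h1
  refine h1.trans (le_of_eq ?_)
  rw [Real.rpow_add hl, Real.rpow_add hl]
  have h2 : C * ((t - s) ^ ((m : ℝ) - j - 1 / r) * (t - s) ^ (1 / p) * A +
      (t - s) ^ (-(j : ℝ) - 1 / q) * (t - s) ^ (1 / p) * B) = (t - s) ^ (1 / p) * S := by
    rw [hS]
    ring
  rw [h2, Real.mul_rpow (by positivity) hS0, ← Real.rpow_mul hl.le, one_div_mul_cancel hp0.ne',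
    Real.rpow_one]

end DerivChainOn

/-! ### Superadditivity, balancing and the decomposition into balanced intervals -/

/-- After division by the right-hand side each term is `T ^ (α + β)`, where `T ≤ 1` is a weighted
geometric mean of the two ratios. Hence it is at most `T`, and so at most the weighted arithmetic
mean; the two arithmetic means add up to `1`. -/
theorem rpow_mul_rpow_add_le {x y z w α β : ℝ} (hx : 0 ≤ x) (hy : 0 ≤ y) (hz : 0 ≤ z) (hw : 0 ≤ w)
    (hα : 0 ≤ α) (hβ : 0 < β) (hαβ : 1 ≤ α + β) :
    x ^ α * y ^ β + z ^ α * w ^ β ≤ (x + z) ^ α * (y + w) ^ β := by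
  have hs : 0 < α + β := by linarith
  have key : ∀ X Y u v : ℝ, 0 ≤ u → 0 ≤ v → u ≤ X → v ≤ Y → 0 < X → 0 < Y →
      u ^ α * v ^ β ≤ X ^ α * Y ^ β * (α / (α + β) * (u / X) + β / (α + β) * (v / Y)) := by
    intro X Y u v hu hv huX hvY hX hY
    have e1 : α / (α + β) + β / (α + β) = 1 := by field_simp
    have h1 := Real.geom_mean_le_arith_mean2_weighted (w₁ := α / (α + β)) (w₂ := β / (α + β))
      (p₁ := u / X) (p₂ := v / Y) (by positivity) (by positivity) (by positivity) (by positivity) e1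
    set T := (u / X) ^ (α / (α + β)) * (v / Y) ^ (β / (α + β)) with hT
    have hT0 : 0 ≤ T := by positivity
    have hT1 : T ≤ 1 := mul_le_one₀
      (Real.rpow_le_one (by positivity) ((div_le_one hX).2 huX) (by positivity)) (by positivity)
      (Real.rpow_le_one (by positivity) ((div_le_one hY).2 hvY) (by positivity))
    have h2 : T ^ (α + β) ≤ T := by
      rcases hT0.eq_or_lt with h | h
      · rw [← h, Real.zero_rpow hs.ne']
      · exact (Real.rpow_le_rpow_of_exponent_ge h hT1 hαβ).trans_eq (Real.rpow_one T)
    have h3 : T ^ (α + β) = (u / X) ^ α * (v / Y) ^ β := by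
      rw [hT, Real.mul_rpow (by positivity) (by positivity), ← Real.rpow_mul (by positivity),
        ← Real.rpow_mul (by positivity), div_mul_cancel₀ _ hs.ne', div_mul_cancel₀ _ hs.ne']
    have h4 : u ^ α * v ^ β = X ^ α * Y ^ β * T ^ (α + β) := by
      rw [h3, Real.div_rpow hu hX.le, Real.div_rpow hv hY.le]
      have := Real.rpow_pos_of_pos hX α
      have := Real.rpow_pos_of_pos hY β
      field_simp
    rw [h4]
    exact mul_le_mul_of_nonneg_left (h2.trans h1) (by positivity)
  rcases (add_nonneg hy hw).eq_or_lt with hY | hY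
  · have hy0 : y = 0 := by linarith
    have hw0 : w = 0 := by linarith
    simp [hy0, hw0, Real.zero_rpow hβ.ne']
  rcases (add_nonneg hx hz).eq_or_lt with hX | hX
  · have hx0 : x = 0 := by linarith
    have hz0 : z = 0 := by linarith
    -- For `α = 0` the factors `0 ^ 0 = 1` survive, and what remains is superadditivity of `y ↦ y ^
    -- β` with `β ≥ 1`.
    rcases hα.eq_or_lt with h | h
    · subst h
      simpa using Real.add_rpow_le_rpow_add hy hw (by simpa using hαβ)
    · simp [hx0, hz0, Real.zero_rpow h.ne']
  · have h1 := key (x + z) (y + w) x y hx hy (by linarith) (by linarith) hX hY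
    have h2 := key (x + z) (y + w) z w hz hw (by linarith) (by linarith) hX hY
    refine (add_le_add h1 h2).trans (le_of_eq ?_)
    rw [← mul_add]
    have : α / (α + β) * (x / (x + z)) + β / (α + β) * (y / (y + w)) +
        (α / (α + β) * (z / (x + z)) + β / (α + β) * (w / (y + w))) = 1 := by
      field_simp
      ring
    rw [this, mul_one]

/-- Interpolation at the balanced length: the case of equality `l ^ κ * A = B`. -/
theorem balanced_interpolation {l A B κ θ : ℝ} (hl : 0 < l) (hA : 0 ≤ A) (hB : 0 ≤ B)
    (hθ : 0 ≤ θ) (hθ1 : θ < 1) (h : l ^ κ * A = B) :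
    l ^ ((1 - θ) * κ) * A + l ^ (-(θ * κ)) * B = 2 * (A ^ θ * B ^ (1 - θ)) := by
  have hk : 0 < l ^ κ := Real.rpow_pos_of_pos hl κ
  have hBs : B = B ^ (1 - θ) * B ^ θ := by
    rw [← Real.rpow_add_of_nonneg hB (by linarith) hθ, sub_add_cancel, Real.rpow_one]
  have hBθ : B ^ θ = l ^ (θ * κ) * A ^ θ := by
    rw [← h, Real.mul_rpow hk.le hA, ← Real.rpow_mul hl.le, mul_comm κ]
  have h1 : l ^ (-(θ * κ)) * B = A ^ θ * B ^ (1 - θ) := by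
    rw [Real.rpow_neg hl.le]
    nth_rewrite 1 [hBs]
    rw [hBθ]
    have := Real.rpow_pos_of_pos hl (θ * κ)
    field_simp
  have h2 : l ^ ((1 - θ) * κ) * A = l ^ (-(θ * κ)) * B := by
    rw [← h, ← mul_assoc, ← Real.rpow_add hl]
    ring_nf
  rw [h2, h1]
  ring

/-- If on every subinterval `[s, t]` the increment of `H` is bounded by a sum of two terms
with opposite scaling in `t - s`, then optimising the lengths of the subintervals gives a
multiplicative bound for the total increment. -/
theorem interpolation_of_subinterval_bounds {a b p q r θ μ K ε : ℝ} {F G H : ℝ → ℝ}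
    (hab : a < b) (hp : 0 < p) (hq : 0 < q) (hr : 0 < r) (hθ : 0 ≤ θ) (hθ1 : θ < 1)
    (hμ : 0 ≤ μ) (hK : 0 ≤ K) (hε : 0 < ε) (hexp : 1 / p ≤ θ / r + (1 - θ) / q)
    (hF : MonotoneOn F (Icc a b)) (hG : MonotoneOn G (Icc a b)) (hH : MonotoneOn H (Icc a b))
    (hFc : ContinuousOn F (Icc a b)) (hGc : ContinuousOn G (Icc a b))
    (hGε : ∀ s ∈ Icc a b, ∀ t ∈ Icc a b, s ≤ t → ε * (t - s) ≤ G t - G s)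
    (hloc : ∀ s ∈ Icc a b, ∀ t ∈ Icc a b, s < t → H t - H s ≤
      (K * ((t - s) ^ ((1 - θ) * (μ + 1 / q)) * (F t - F s) ^ (1 / r) +
        (t - s) ^ (-(θ * (μ + 1 / q))) * (G t - G s) ^ (1 / q))) ^ p) :
    H b - H a ≤ 2 * (2 * K) ^ p * ((F b - F a) ^ (1 / r * θ * p) *
        (G b - G a) ^ (1 / q * (1 - θ) * p)) +
      (2 * K * (b - a) ^ (-(θ * (μ + 1 / q)))) ^ p * (G b - G a) ^ (1 / q * p) := by
  set κ := μ + 1 / q with hκ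
  have haI : a ∈ Icc a b := left_mem_Icc.2 hab.le
  have hbI : b ∈ Icc a b := right_mem_Icc.2 hab.le
  have hκ0 : 0 < κ := by positivity
  have h1θ : 0 < 1 - θ := by linarith
  set Φ : ℝ → ℝ → ℝ := fun s t =>
    (F t - F s) ^ (1 / r * θ * p) * (G t - G s) ^ (1 / q * (1 - θ) * p) with hΦ
  -- The sign of `D s t` tells which of the two local terms dominates; a zero means `[s, t]` is
  -- balanced.
  set D : ℝ → ℝ → ℝ := fun s t =>
    (t - s) ^ κ * (F t - F s) ^ (1 / r) - (G t - G s) ^ (1 / q) with hD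
  have hF0 : ∀ s ∈ Icc a b, ∀ t ∈ Icc a b, s ≤ t → 0 ≤ F t - F s := fun s hs t ht hst =>
    sub_nonneg.2 (hF hs ht hst)
  have hG0 : ∀ s ∈ Icc a b, ∀ t ∈ Icc a b, s ≤ t → 0 ≤ G t - G s := fun s hs t ht hst =>
    sub_nonneg.2 (hG hs ht hst)
  have hΦ0 : ∀ s ∈ Icc a b, ∀ t ∈ Icc a b, s ≤ t → 0 ≤ Φ s t := fun s hs t ht hst =>
    mul_nonneg (Real.rpow_nonneg (hF0 s hs t ht hst) _) (Real.rpow_nonneg (hG0 s hs t ht hst) _)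
  have hbal : ∀ s ∈ Icc a b, ∀ t ∈ Icc a b, s < t → D s t = 0 →
      H t - H s ≤ (2 * K) ^ p * Φ s t := by
    intro s hs t ht hst h0
    have hf := hF0 s hs t ht hst.le
    have hg := hG0 s hs t ht hst.le
    refine (hloc s hs t ht hst).trans (le_of_eq ?_)
    rw [balanced_interpolation (sub_pos.2 hst) (Real.rpow_nonneg hf _) (Real.rpow_nonneg hg _)
      hθ hθ1 (sub_eq_zero.1 h0), ← mul_assoc, mul_comm K 2, Real.mul_rpow (x := 2 * K) (by positivity)
      (by positivity), ← Real.rpow_mul hf, ← Real.rpow_mul hg,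
      Real.mul_rpow (Real.rpow_nonneg hf _) (Real.rpow_nonneg hg _), ← Real.rpow_mul hf, ← Real.rpow_mul hg]
  have hT0 : 0 ≤ (2 * K * (b - a) ^ (-(θ * κ))) ^ p * (G b - G a) ^ (1 / q * p) :=
    mul_nonneg (Real.rpow_nonneg (mul_nonneg (by positivity) (Real.rpow_nonneg (by linarith) _)) _)
      (Real.rpow_nonneg (hG0 a haI b hbI hab.le) _)
  have hab0 : 0 < b - a := sub_pos.2 hab
  -- Here the `G` term dominates on all of `[a, b]`, and the second summand of the claim alone
  -- suffices.
  by_cases hDab : D a b ≤ 0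
  · have hf := hF0 a haI b hbI hab.le
    have hg := hG0 a haI b hbI hab.le
    have h1 : (b - a) ^ ((1 - θ) * κ) * (F b - F a) ^ (1 / r) ≤
        (b - a) ^ (-(θ * κ)) * (G b - G a) ^ (1 / q) := by
      have : (b - a) ^ ((1 - θ) * κ) = (b - a) ^ (-(θ * κ)) * (b - a) ^ κ := by
        rw [← Real.rpow_add hab0]
        ring_nf
      rw [this, mul_assoc]
      exact mul_le_mul_of_nonneg_left (sub_nonpos.1 hDab) (by positivity)
    have h2 : H b - H a ≤ (2 * K * (b - a) ^ (-(θ * κ))) ^ p * (G b - G a) ^ (1 / q * p) := by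
      refine (hloc a haI b hbI hab).trans ?_
      rw [Real.rpow_mul hg, ← Real.mul_rpow (by positivity) (by positivity)]
      refine Real.rpow_le_rpow (by positivity) ?_ hp.le
      calc _ ≤ K * ((b - a) ^ (-(θ * κ)) * (G b - G a) ^ (1 / q) +
            (b - a) ^ (-(θ * κ)) * (G b - G a) ^ (1 / q)) := by gcongr
        _ = _ := by ring
    have := mul_nonneg (show 0 ≤ 2 * (2 * K) ^ p by positivity) (hΦ0 a haI b hbI hab.le)
    linarith
  push Not at hDab
  -- On short intervals the `G` term wins: it is at least `(ε (t - s)) ^ (1 / q)`, while the other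
  -- is `(t - s) ^ (1 / q)` times a factor made small by uniform continuity of `F`. Balanced
  -- intervals are thus longer than `δ`, and finitely many exhaust `[a, b]`.
  obtain ⟨δ, hδ, hδD⟩ : ∃ δ > 0, ∀ s ∈ Icc a b, ∀ t ∈ Icc a b, s < t → t - s ≤ δ → D s t < 0 := by
    have huc := isCompact_Icc.uniformContinuousOn_of_continuous hFc
    rw [Metric.uniformContinuousOn_iff] at huc
    have hη : 0 < (ε ^ (1 / q) / (b - a) ^ μ) ^ r := by positivity
    obtain ⟨δ, hδ, hδ'⟩ := huc _ hη
    refine ⟨δ / 2, by positivity, fun s hs t ht hst hlt => ?_⟩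
    have hf := hF0 s hs t ht hst.le
    have hl : 0 < t - s := sub_pos.2 hst
    have h1 := hδ' t ht s hs (by rw [Real.dist_eq, abs_of_pos hl]; linarith)
    rw [Real.dist_eq, abs_of_nonneg hf] at h1
    have h2 := Real.rpow_lt_rpow hf h1 (show 0 < 1 / r by positivity)
    rw [← Real.rpow_mul (by positivity), mul_one_div_cancel hr.ne', Real.rpow_one,
      lt_div_iff₀ (by positivity)] at h2
    have h3 : (t - s) ^ μ ≤ (b - a) ^ μ :=
      Real.rpow_le_rpow hl.le (by linarith [hs.1, ht.2]) hμ
    have h4 : (ε * (t - s)) ^ (1 / q) ≤ (G t - G s) ^ (1 / q) :=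
      Real.rpow_le_rpow (by positivity) (hGε s hs t ht hst.le) (by positivity)
    rw [Real.mul_rpow hε.le hl.le] at h4
    have h5 : (t - s) ^ κ * (F t - F s) ^ (1 / r) < ε ^ (1 / q) * (t - s) ^ (1 / q) := by
      rw [hκ, Real.rpow_add hl]
      have h6 : (0 : ℝ) < (t - s) ^ (1 / q) := by positivity
      have h7 : (t - s) ^ μ * (F t - F s) ^ (1 / r) ≤ (F t - F s) ^ (1 / r) * (b - a) ^ μ := by
        rw [mul_comm]
        gcongr
      nlinarith
    exact sub_neg.2 (h5.trans_le h4)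
  have hDr : ∀ s ∈ Icc a b, ContinuousOn (D s) (Icc s b) := fun s hs => by
    have hsub : Icc s b ⊆ Icc a b := Icc_subset_Icc hs.1 le_rfl
    refine ((Continuous.continuousOn (by fun_prop)).rpow_const (fun x _ => Or.inr hκ0.le) |>.mul
      (((hFc.mono hsub).sub continuousOn_const).rpow_const fun x _ => Or.inr (by positivity))).sub
      (((hGc.mono hsub).sub continuousOn_const).rpow_const fun x _ => Or.inr (by positivity))
  have hDl : ContinuousOn (fun s => D s b) (Icc a b) := by
    refine ((Continuous.continuousOn (by fun_prop)).rpow_const (fun x _ => Or.inr hκ0.le) |>.mul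
      ((continuousOn_const.sub hFc).rpow_const fun x _ => Or.inr (by positivity))).sub
      ((continuousOn_const.sub hGc).rpow_const fun x _ => Or.inr (by positivity))
  have hend : ∀ s ∈ Icc a b, s = b → H b - H s ≤ (2 * K) ^ p * Φ s b + (2 * K) ^ p * Φ a b := by
    intro s hs h
    have h1 := hΦ0 a haI b hbI hab.le
    have h2 := hΦ0 s hs b hbI hs.2
    have h3 : H b - H s = 0 := by rw [h, sub_self]
    rw [h3]
    exact add_nonneg (mul_nonneg (by positivity) h2) (mul_nonneg (by positivity) h1)
  -- The extra `Φ a b` pays for the last piece, which may overlap earlier ones. It is spent only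
  -- once, as that piece ends the recursion; this is the factor `2` in the conclusion.
  have hmain : ∀ n : ℕ, ∀ s ∈ Icc a b, b - s ≤ n * δ →
      H b - H s ≤ (2 * K) ^ p * Φ s b + (2 * K) ^ p * Φ a b := by
    intro n
    induction n with
    | zero =>
      intro s hs hsn
      exact hend s hs (le_antisymm hs.2 (by simpa using hsn))
    | succ n ih =>
      intro s hs hsn
      rcases hs.2.eq_or_lt with hsb | hsb
      · exact hend s hs hsb
      have hΦs := hΦ0 s hs b hbI hs.2
      have hΦa := hΦ0 a haI b hbI hab.le
      by_cases hDs : D s b ≤ 0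
      -- The remainder `[s, b]` is too short to balance, so it is enlarged to the left until `[y,
      -- b]` is balanced; this is possible because `D a b > 0`.
      · obtain ⟨y, hy, hy0⟩ : (0 : ℝ) ∈ (fun x => D x b) '' Icc a s :=
          intermediate_value_Icc' hs.1 (hDl.mono (Icc_subset_Icc le_rfl hs.2)) ⟨hDs, hDab.le⟩
        have hyI : y ∈ Icc a b := ⟨hy.1, hy.2.trans hs.2⟩
        have hyb : y < b := hy.2.trans_lt hsb
        have h1 := hbal y hyI b hbI hyb hy0
        have h2 : Φ y b ≤ Φ a b := by
          have := hF0 y hyI b hbI hyb.le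
          have := hG0 y hyI b hbI hyb.le
          have := hF0 a haI b hbI hab.le
          have h3 := hF haI hyI hy.1
          have h4 := hG haI hyI hy.1
          simp only [hΦ]
          gcongr
        have h3 := hH hyI hs hy.2
        have h4 := mul_le_mul_of_nonneg_left h2 (show 0 ≤ (2 * K) ^ p by positivity)
        have := mul_nonneg (show 0 ≤ (2 * K) ^ p by positivity) hΦs
        linarith
      · push Not at hDs
        have hsd : s + δ ≤ b := by
          by_contra! h
          exact (hδD s hs b hbI hsb (by linarith)).not_gt hDs
        have hsdI : s + δ ∈ Icc a b := ⟨by linarith [hs.1], hsd⟩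
        have hneg := hδD s hs (s + δ) hsdI (by linarith) (by linarith)
        -- `D s` changes sign between `s + δ` and `b`, so a balanced `[s, t]` of length at least `δ`
        -- can be split off.
        obtain ⟨t, ht, ht0⟩ : (0 : ℝ) ∈ D s '' Icc (s + δ) b :=
          intermediate_value_Icc hsd ((hDr s hs).mono (Icc_subset_Icc (by linarith) le_rfl))
            ⟨hneg.le, hDs.le⟩
        have htI : t ∈ Icc a b := ⟨hsdI.1.trans ht.1, ht.2⟩
        have hst : s < t := by linarith [ht.1]
        have h1 := hbal s hs t htI hst ht0
        have h2 := ih t htI (by push_cast at hsn; linarith [ht.1])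
        have h3 : Φ s t + Φ t b ≤ Φ s b := by
          have := rpow_mul_rpow_add_le (hF0 s hs t htI hst.le) (hG0 s hs t htI hst.le)
            (hF0 t htI b hbI ht.2) (hG0 t htI b hbI ht.2) (α := 1 / r * θ * p)
            (β := 1 / q * (1 - θ) * p) (by positivity) (by positivity) (by
              rw [← add_mul]
              rw [div_le_iff₀ hp] at hexp
              refine hexp.trans (le_of_eq ?_)
              ring)
          simp only [hΦ]
          convert! this using 3 <;> ring
        have h4 := mul_le_mul_of_nonneg_left h3 (show 0 ≤ (2 * K) ^ p by positivity)
        linarith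
  obtain ⟨n, hn⟩ := exists_nat_ge ((b - a) / δ)
  have := hmain n a haI ((div_le_iff₀ hδ).1 hn)
  change H b - H a ≤ 2 * (2 * K) ^ p * Φ a b + _
  linarith

/-! ### Weak derivatives and absolutely continuous representatives -/

/-- **Du Bois-Reymond lemma**: on a bounded interval, an integrable function with an integrable
weak derivative agrees almost everywhere with a primitive of that derivative. -/
theorem exists_ae_eq_add_integral {a b : ℝ} (hab : a < b) {v w : ℝ → ℝ}
    (hv : IntegrableOn v (Ioo a b)) (hw : IntegrableOn w (Ioo a b))
    (h : ∀ φ : ℝ → ℝ, ContDiff ℝ ∞ φ → HasCompactSupport φ → tsupport φ ⊆ Ioo a b →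
      ∫ x in Ioo a b, v x * deriv φ x = -∫ x in Ioo a b, w x * φ x) :
    ∃ c : ℝ, ∀ᵐ x ∂volume.restrict (Ioo a b), v x = c + ∫ y in a..x, w y := by
  have hwI : IntervalIntegrable w volume a b :=
    (intervalIntegrable_iff_integrableOn_Ioo_of_le hab.le).2 hw
  set W : ℝ → ℝ := fun x => ∫ y in a..x, w y with hW
  have hWac : AbsolutelyContinuousOnInterval W a b :=
    hwI.absolutelyContinuousOnInterval_intervalIntegral left_mem_uIcc
  have hWint : IntegrableOn W (Ioo a b) := by
    have := hWac.continuousOn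
    rw [uIcc_of_le hab.le] at this
    exact (this.integrableOn_Icc).mono_set Ioo_subset_Icc_self
  have hzero : ∀ φ : ℝ → ℝ, tsupport φ ⊆ Ioo a b → ∀ x ∉ Ioo a b, φ x = 0 := fun φ hφ x hx =>
    image_eq_zero_of_notMem_tsupport fun h => hx (hφ h)
  have hII : ∀ f : ℝ → ℝ, ∫ x in Ioo a b, f x = ∫ x in a..b, f x := fun f => by
    rw [intervalIntegral.integral_of_le hab.le, integral_Ioc_eq_integral_Ioo]
  have hWparts : ∀ φ : ℝ → ℝ, ContDiff ℝ ∞ φ → HasCompactSupport φ → tsupport φ ⊆ Ioo a b →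
      ∫ x in Ioo a b, W x * deriv φ x = -∫ x in Ioo a b, w x * φ x := by
    intro φ hφ _ hφs
    have hφac : AbsolutelyContinuousOnInterval φ a b :=
      (hφ.of_le (by norm_num)).contDiffOn.absolutelyContinuousOnInterval
    have hd : ∫ x in a..b, deriv W x * φ x = ∫ x in a..b, w x * φ x := by
      refine intervalIntegral.integral_congr_ae ?_
      filter_upwards [hwI.ae_hasDerivAt_integral] with x hx hxI
      rw [(hx (uIoc_subset_uIcc hxI) a left_mem_uIcc).deriv]
    rw [hII, hII, hWac.integral_mul_deriv_eq_deriv_mul hφac, hzero φ hφs a (by simp),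
      hzero φ hφs b (by simp), hd]
    ring
  have hmul : ∀ {f : ℝ → ℝ}, IntegrableOn f (Ioo a b) → ∀ φ : ℝ → ℝ, Continuous φ →
      IntegrableOn (fun x => f x * φ x) (Ioo a b) := fun {f} hf φ hφ => by
    rw [← intervalIntegrable_iff_integrableOn_Ioo_of_le hab.le] at hf ⊢
    exact hf.mul_continuousOn hφ.continuousOn
  set d : ℝ → ℝ := fun x => v x - W x with hd
  have hdint : IntegrableOn d (Ioo a b) := hv.sub hWint
  have hdφ : ∀ φ : ℝ → ℝ, ContDiff ℝ ∞ φ → HasCompactSupport φ → tsupport φ ⊆ Ioo a b →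
      ∫ x in Ioo a b, d x * deriv φ x = 0 := by
    intro φ hφ hφc hφs
    have hcd : Continuous (deriv φ) := hφ.continuous_deriv (by norm_num)
    simp only [hd, sub_mul]
    rw [integral_sub (hmul hv _ hcd) (hmul hWint _ hcd), h φ hφ hφc hφs, hWparts φ hφ hφc hφs,
      sub_self]
  -- A test function of mean zero is the derivative of a test function, since its primitive vanishes
  -- near both endpoints.
  have hmean : ∀ ψ : ℝ → ℝ, ContDiff ℝ ∞ ψ → HasCompactSupport ψ → tsupport ψ ⊆ Ioo a b →
      ∫ x in Ioo a b, ψ x = 0 → ∫ x in Ioo a b, d x * ψ x = 0 := by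
    intro ψ hψ hψc hψs hψ0
    set φ : ℝ → ℝ := fun x => ∫ y in a..x, ψ y with hφ
    have hder : ∀ x, HasDerivAt φ (ψ x) x := fun x =>
      intervalIntegral.integral_hasDerivAt_right (hψ.continuous.intervalIntegrable _ _)
        (hψ.continuous.stronglyMeasurableAtFilter _ _) hψ.continuous.continuousAt
    have hderiv : deriv φ = ψ := funext fun x => (hder x).deriv
    have hφs : ContDiff ℝ ∞ φ := by
      rw [contDiff_infty_iff_deriv]
      exact ⟨fun x => (hder x).differentiableAt, hderiv ▸ hψ⟩
    obtain ⟨a', b', haa', hbb', hsub⟩ : ∃ a' b', a < a' ∧ b' < b ∧ tsupport ψ ⊆ Icc a' b' := by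
      rcases (tsupport ψ).eq_empty_or_nonempty with he | hne
      · exact ⟨a + 1, b - 1, by linarith, by linarith, by simp [he]⟩
      · obtain ⟨x, hx⟩ := hψc.isCompact.exists_isLeast hne
        obtain ⟨y, hy⟩ := hψc.isCompact.exists_isGreatest hne
        exact ⟨x, y, (hψs hx.1).1, (hψs hy.1).2, fun z hz => ⟨hx.2 hz, hy.2 hz⟩⟩
    have hψz : ∀ x, x ∉ Icc a' b' → ψ x = 0 := fun x hx =>
      image_eq_zero_of_notMem_tsupport fun h => hx (hsub h)
    have hφz : ∀ x, x ∉ Icc a' b' → φ x = 0 := by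
      intro x hx
      by_cases hxa : x < a'
      · simp only [hφ]
        rw [intervalIntegral.integral_congr (g := fun _ => (0 : ℝ)), intervalIntegral.integral_zero]
        intro y hy
        refine hψz y fun hy' => ?_
        have := (uIcc_subset_Icc (a₂ := min a x) (b₂ := max a x) (by simp) (by simp) hy).2
        exact absurd hy'.1 (not_le.2 (this.trans_lt (max_lt haa' hxa)))
      · have hxb : b' < x := by
          by_contra! hle
          exact hx ⟨not_lt.1 hxa, hle⟩
        have h1 : φ x = φ b + ∫ y in b..x, ψ y := by
          rw [hφ, intervalIntegral.integral_add_adjacent_intervals] <;>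
            exact hψ.continuous.intervalIntegrable _ _
        have h2 : φ b = 0 := (hII ψ).symm.trans hψ0
        rw [h1, h2, zero_add, intervalIntegral.integral_congr (g := fun _ => (0 : ℝ)),
          intervalIntegral.integral_zero]
        intro y hy
        refine hψz y fun hy' => ?_
        have := (uIcc_subset_Icc (a₂ := min b x) (b₂ := max b x) (by simp) (by simp) hy).1
        exact absurd hy'.2 (not_le.2 ((lt_min hbb' hxb).trans_le this))
    have hts : tsupport φ ⊆ Icc a' b' :=
      closure_minimal (fun x hx => by_contra fun hx' => hx (hφz x hx')) isClosed_Icc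
    have := hdφ φ hφs (isCompact_Icc.of_isClosed_subset (isClosed_tsupport φ) hts)
      (hts.trans (Icc_subset_Ioo haa' hbb'))
    rwa [hderiv] at this
  -- Subtracting a multiple of the normalised bump `ρ` gives any test function mean zero; so `d`
  -- acts on test functions as the constant `∫ d ρ`.
  obtain ⟨ρ, hρs, hρc, hρ, hρ1⟩ : ∃ ρ : ℝ → ℝ, tsupport ρ ⊆ Ioo a b ∧ HasCompactSupport ρ ∧
      ContDiff ℝ ∞ ρ ∧ ∫ x in Ioo a b, ρ x = 1 := by
    set f : ContDiffBump ((a + b) / 2) :=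
      ⟨(b - a) / 8, (b - a) / 4, by linarith, by linarith⟩ with hf
    have hsup : tsupport (f.normed volume) ⊆ Ioo a b := by
      rw [f.tsupport_normed_eq, Real.closedBall_eq_Icc]
      exact Icc_subset_Ioo (by simp only [hf]; linarith) (by simp only [hf]; linarith)
    refine ⟨f.normed volume, hsup, f.hasCompactSupport_normed, f.contDiff_normed, ?_⟩
    rw [setIntegral_eq_integral_of_forall_compl_eq_zero (hzero _ hsup), f.integral_normed]
  set c := ∫ x in Ioo a b, d x * ρ x with hc
  refine ⟨c, ?_⟩
  have hfin := isOpen_Ioo.ae_eq_zero_of_integral_contDiff_smul_eq_zero (μ := volume) (U := Ioo a b)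
    (f := fun x => d x - c) (hdint.sub (integrableOn_const (by simp))).locallyIntegrableOn (by
      intro ψ hψ hψc hψs
      rw [← setIntegral_eq_integral_of_forall_compl_eq_zero (s := Ioo a b) fun x hx => by
        rw [hzero ψ hψs x hx, zero_smul]]
      set e := ∫ x in Ioo a b, ψ x with he
      have hψi : IntegrableOn ψ (Ioo a b) :=
        (hψ.continuous.integrable_of_hasCompactSupport hψc).integrableOn
      have hρi : IntegrableOn ρ (Ioo a b) :=
        (hρ.continuous.integrable_of_hasCompactSupport hρc).integrableOn
      have h1 := hmean (fun x => ψ x - e * ρ x) (hψ.sub (contDiff_const.mul hρ))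
        (hψc.sub (hρc.mul_left (f := fun _ => e)))
        ((tsupport_sub _ _).trans (union_subset hψs
          ((tsupport_mul_subset_right (f := fun _ => e)).trans hρs)))
        (by rw [integral_sub hψi (hρi.const_mul e), integral_const_mul, hρ1, mul_one, sub_self])
      have h2 : ∀ x, d x * (ψ x - e * ρ x) = d x * ψ x - e * (d x * ρ x) := fun x => by ring
      simp only [h2] at h1
      rw [integral_sub (hmul hdint _ hψ.continuous) ((hmul hdint _ hρ.continuous).const_mul e),
        integral_const_mul, ← hc] at h1
      have h3 : ∀ x, ψ x • (d x - c) = d x * ψ x - c * ψ x := fun x => by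
        rw [smul_eq_mul]
        ring
      simp only [h3]
      rw [integral_sub (hmul hdint _ hψ.continuous) (hψi.const_mul c), integral_const_mul, ← he]
      linarith)
  rw [ae_restrict_iff' measurableSet_Ioo]
  filter_upwards [hfin] with x hx hxI
  have := hx hxI
  simp only [hd] at this
  linarith

theorem HasWeakDerivOn.ae_eq {a b : ℝ} {k : ℕ} {u u' v v' : ℝ → ℝ}
    (h : HasWeakDerivOn (Ioo a b) k u v) (h' : HasWeakDerivOn (Ioo a b) k u' v')
    (hu : u =ᵐ[volume.restrict (Ioo a b)] u') : v =ᵐ[volume.restrict (Ioo a b)] v' := by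
  have hfin := isOpen_Ioo.ae_eq_zero_of_integral_contDiff_smul_eq_zero (μ := volume) (U := Ioo a b)
    (f := fun x => v x - v' x) (h.2.1.sub h'.2.1) (by
      intro ψ hψ hψc hψs
      have hz : ∀ x ∉ Ioo a b, ψ x = 0 := fun x hx =>
        image_eq_zero_of_notMem_tsupport fun h => hx (hψs h)
      have hint : ∀ w : ℝ → ℝ, LocallyIntegrableOn w (Ioo a b) →
          IntegrableOn (fun x => w x * ψ x) (Ioo a b) := by
        intro w hw
        have h1 : IntegrableOn (fun x => w x * ψ x) (tsupport ψ) :=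
          (hw.integrableOn_compact_subset hψs hψc).mul_continuousOn hψ.continuous.continuousOn hψc
        refine ((integrableOn_iff_integrable_of_support_subset fun x hx => ?_).1 h1).integrableOn
        exact subset_tsupport ψ (right_ne_zero_of_mul hx)
      rw [← setIntegral_eq_integral_of_forall_compl_eq_zero (s := Ioo a b) fun x hx => by
        rw [hz x hx, zero_smul]]
      have h3 : ∀ x, ψ x • (v x - v' x) = v x * ψ x - v' x * ψ x := fun x => by
        rw [smul_eq_mul]
        ring
      simp only [h3]
      rw [integral_sub (hint v h.2.1) (hint v' h'.2.1)]
      have h4 := h.2.2 ψ hψ hψc hψs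
      have h5 := h'.2.2 ψ hψ hψc hψs
      have h6 : ∫ x in Ioo a b, u x * iteratedDeriv k ψ x =
          ∫ x in Ioo a b, u' x * iteratedDeriv k ψ x :=
        integral_congr_ae (hu.mono fun x hx => by simp only [hx])
      rw [h4, h5] at h6
      rw [mul_left_cancel₀ (pow_ne_zero k (by norm_num)) h6, sub_self])
  rw [Filter.EventuallyEq, ae_restrict_iff' measurableSet_Ioo]
  filter_upwards [hfin] with x hx hxI
  exact sub_eq_zero.1 (hx hxI)

/-- A Sobolev function on a bounded interval has a chain of absolutely continuous
representatives of its weak derivatives. -/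
theorem MemSobolev.exists_derivChainOn {a b : ℝ} (hab : a < b) {m : ℕ} {r : ℝ≥0∞} (hr : 1 ≤ r)
    {u : ℝ → ℝ} (hu : MemSobolev (Ioo a b) m r u) :
    ∃ g : ℕ → ℝ → ℝ, DerivChainOn m g a b ∧
      (∀ i ≤ m, ∀ v, HasWeakDerivOn (Ioo a b) i u v → v =ᵐ[volume.restrict (Ioo a b)] g i) ∧
      g 0 =ᵐ[volume.restrict (Ioo a b)] u ∧ MemLp (g m) r (volume.restrict (Ioo a b)) := by
  have hex : ∀ i, ∃ v : ℝ → ℝ, i ≤ m →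
      HasWeakDerivOn (Ioo a b) i u v ∧ MemLp v r (volume.restrict (Ioo a b)) := fun i => by
    by_cases hi : i ≤ m
    · obtain ⟨v, hv⟩ := hu.2 i hi
      exact ⟨v, fun _ => hv⟩
    · exact ⟨0, fun h => absurd h hi⟩
  choose v hv using hex
  have hvint : ∀ i ≤ m, IntegrableOn (v i) (Ioo a b) := fun i hi => (hv i hi).2.integrable hr
  have hvI : ∀ i ≤ m, IntervalIntegrable (v i) volume a b := fun i hi =>
    (intervalIntegrable_iff_integrableOn_Ioo_of_le hab.le).2 (hvint i hi)
  have hprim : ∀ i, ∃ c : ℝ, i < m →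
      ∀ᵐ x ∂volume.restrict (Ioo a b), v i x = c + ∫ y in a..x, v (i + 1) y := fun i => by
    by_cases hi : i < m
    · obtain ⟨c, hc⟩ := exists_ae_eq_add_integral hab (hvint i hi.le) (hvint (i + 1) hi) (by
        intro φ hφ hφc hφs
        -- Testing order `i` against `φ'` and order `i + 1` against `φ` shows that `v (i + 1)` is
        -- the first weak derivative of `v i`.
        have h1 := (hv i hi.le).1.2.2 (deriv φ) (contDiff_infty_iff_deriv.1 hφ).2 hφc.deriv
          ((tsupport_deriv_subset (f := φ)).trans hφs)
        have h2 := (hv (i + 1) hi).1.2.2 φ hφ hφc hφs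
        rw [iteratedDeriv_succ'] at h2
        rw [h2, pow_succ, mul_assoc] at h1
        have := mul_left_cancel₀ (pow_ne_zero i (by norm_num)) h1
        rw [← this]
        ring)
      exact ⟨c, fun _ => hc⟩
    · exact ⟨0, fun h => absurd h hi⟩
  choose c hc using hprim
  -- Only orders below `m` are replaced by primitives; the top derivative need not be continuous and
  -- stays `v m`.
  set g : ℕ → ℝ → ℝ := fun i x => if i < m then c i + ∫ y in a..x, v (i + 1) y else v i x with hg
  have hgv : ∀ i ≤ m, v i =ᵐ[volume.restrict (Ioo a b)] g i := fun i hi => by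
    by_cases hlt : i < m
    · simp only [hg, hlt, if_true]
      exact hc i hlt
    · simp only [hg, hlt, if_false]
      exact Filter.EventuallyEq.rfl
  have hcongr : ∀ i ≤ m, ∀ x ∈ Icc a b, ∀ y ∈ Icc a b, ∫ z in x..y, v i z = ∫ z in x..y, g i z := by
    intro i hi x hx y hy
    refine intervalIntegral.integral_congr_ae_restrict (ae_mono ?_ (hgv i hi))
    rw [Measure.restrict_congr_set Ioo_ae_eq_Ioc]
    exact Measure.restrict_mono (Ioc_subset_Ioc (le_min hx.1 hy.1) (max_le hx.2 hy.2)) le_rfl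
  refine ⟨g, ⟨fun i hi => ?_, fun i hi x hx y hy => ?_⟩, fun i hi w hw => ?_, ?_, ?_⟩
  · rw [intervalIntegrable_iff_integrableOn_Ioo_of_le hab.le]
    exact (hvint i hi).congr (hgv i hi)
  · rw [← hcongr (i + 1) hi x hx y hy]
    simp only [hg, hi, if_true]
    have h1 := (hvI (i + 1) hi).mono_set (uIcc_subset_uIcc left_mem_uIcc (Icc_subset_uIcc hx))
    have h2 := (hvI (i + 1) hi).mono_set (uIcc_subset_uIcc left_mem_uIcc (Icc_subset_uIcc hy))
    rw [add_sub_add_left_eq_sub, intervalIntegral.integral_interval_sub_left h2 h1]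
  · exact (hw.ae_eq (hv i hi).1 Filter.EventuallyEq.rfl).trans (hgv i hi)
  · have h0 : HasWeakDerivOn (Ioo a b) 0 u u :=
      ⟨(hv 0 (Nat.zero_le _)).1.1, (hv 0 (Nat.zero_le _)).1.1, fun φ _ _ _ => by simp⟩
    exact ((h0.ae_eq (hv 0 (Nat.zero_le _)).1 Filter.EventuallyEq.rfl).trans
      (hgv 0 (Nat.zero_le _))).symm
  · exact ((hv m le_rfl).2).ae_eq (hgv m le_rfl)

/-! ### The global estimate and its translation to Lebesgue norms -/

theorem DerivChainOn.exists_integral_rpow_le_interpolation {a b : ℝ} (hab : a < b) {p q r : ℝ}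
    (hp : 1 ≤ p) (hq : 1 ≤ q) (hr : 1 ≤ r) {j m : ℕ} (hjm : j < m) {θ : ℝ}
    (hscale : 1 / p = (j : ℝ) + θ * (1 / r - (m : ℝ)) + (1 - θ) / q)
    (hθ : (j : ℝ) / (m : ℝ) ≤ θ) (hθ1 : θ < 1) :
    ∃ C : ℝ, 0 < C ∧ ∀ g : ℕ → ℝ → ℝ, DerivChainOn m g a b →
      IntervalIntegrable (fun x => |g 0 x| ^ q) volume a b →
      IntervalIntegrable (fun x => |g m x| ^ r) volume a b →
      ∫ x in a..b, |g j x| ^ p ≤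
        (C * (((∫ x in a..b, |g m x| ^ r) ^ (1 / r)) ^ θ *
            ((∫ x in a..b, |g 0 x| ^ q) ^ (1 / q)) ^ (1 - θ) +
          (∫ x in a..b, |g 0 x| ^ q) ^ (1 / q))) ^ p := by
  obtain ⟨K, hK, hloc⟩ := DerivChainOn.exists_integral_rpow_le m
  have hp0 : 0 < p := by linarith
  have hq0 : 0 < q := by linarith
  have hr0 : 0 < r := by linarith
  have hm0 : (0 : ℝ) < m := by exact_mod_cast (Nat.zero_le j).trans_lt hjm
  have hm1 : (1 : ℝ) ≤ m := by exact_mod_cast (Nat.zero_le j).trans_lt hjm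
  have hθ0 : 0 ≤ θ := le_trans (by positivity) hθ
  have h1θ : 0 < 1 - θ := by linarith
  have hl : 0 < b - a := sub_pos.2 hab
  have hr1 : 1 / r ≤ 1 := (div_le_one hr0).2 hr
  set μ : ℝ := m - 1 / r with hμ
  have hμ0 : 0 ≤ μ := by linarith
  set L := (b - a) ^ (-(θ * (μ + 1 / q))) with hL
  have hL0 : 0 < L := Real.rpow_pos_of_pos hl _
  -- `4 * K` arises from `2 * (2 * K) ^ p ≤ (4 * K) ^ p`, valid as `p ≥ 1`; `2 * K * L` comes from
  -- the case where the whole interval is too short.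
  refine ⟨4 * K + 2 * K * L, by positivity, fun g hg hiq hir => ?_⟩
  have hij : IntervalIntegrable (fun x => |g j x| ^ p) volume a b := by
    apply ContinuousOn.intervalIntegrable
    rw [uIcc_of_le hab.le]
    exact (hg.continuousOn hab.le hjm).abs.rpow_const fun x _ => Or.inr hp0.le
  have hsub : ∀ {f : ℝ → ℝ}, IntervalIntegrable f volume a b → ∀ s ∈ Icc a b, ∀ t ∈ Icc a b,
      IntervalIntegrable f volume s t := fun hf s hs t ht =>
    hf.mono_set (uIcc_subset_uIcc (Icc_subset_uIcc hs) (Icc_subset_uIcc ht))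
  have haI : a ∈ Icc a b := left_mem_Icc.2 hab.le
  have hincr : ∀ {f : ℝ → ℝ}, IntervalIntegrable f volume a b → ∀ s ∈ Icc a b, ∀ t ∈ Icc a b,
      (∫ x in a..t, f x) - ∫ x in a..s, f x = ∫ x in s..t, f x := fun hf s hs t ht =>
    intervalIntegral.integral_interval_sub_left (hsub hf a haI t ht) (hsub hf a haI s hs)
  have hmono : ∀ {f : ℝ → ℝ}, IntervalIntegrable f volume a b → (∀ x, 0 ≤ f x) →
      MonotoneOn (fun t => ∫ x in a..t, f x) (Icc a b) := fun {f} hf hf0 s hs t ht hst => by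
    rw [← sub_nonneg, hincr hf s hs t ht]
    exact intervalIntegral.integral_nonneg hst fun x _ => hf0 x
  have hcont : ∀ {f : ℝ → ℝ}, IntervalIntegrable f volume a b →
      ContinuousOn (fun t => ∫ x in a..t, f x) (Icc a b) := fun {f} hf => by
    have := intervalIntegral.continuousOn_primitive_interval' hf left_mem_uIcc
    rwa [uIcc_of_le hab.le] at this
  set A := ∫ x in a..b, |g m x| ^ r with hA
  set B := ∫ x in a..b, |g 0 x| ^ q with hB
  have hA0 : 0 ≤ A := intervalIntegral.integral_nonneg hab.le fun x _ =>
    Real.rpow_nonneg (abs_nonneg _) _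
  have hB0 : 0 ≤ B := intervalIntegral.integral_nonneg hab.le fun x _ =>
    Real.rpow_nonneg (abs_nonneg _) _
  -- Adding `ε` to `|g 0| ^ q` makes `G` grow at least linearly even where `g 0` vanishes, as the
  -- decomposition requires.
  have hεbound : ∀ ε > 0, ∫ x in a..b, |g j x| ^ p ≤
      2 * (2 * K) ^ p * (A ^ (1 / r * θ * p) * (B + ε * (b - a)) ^ (1 / q * (1 - θ) * p)) +
        (2 * K * L) ^ p * (B + ε * (b - a)) ^ (1 / q * p) := by
    intro ε hε
    have hiε : IntervalIntegrable (fun x => |g 0 x| ^ q + ε) volume a b :=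
      hiq.add intervalIntegrable_const
    have hadd : ∀ s ∈ Icc a b, ∀ t ∈ Icc a b,
        ∫ x in s..t, (|g 0 x| ^ q + ε) = (∫ x in s..t, |g 0 x| ^ q) + ε * (t - s) :=
      fun s hs t ht => by
        rw [intervalIntegral.integral_add (hsub hiq s hs t ht) intervalIntegrable_const,
          intervalIntegral.integral_const, smul_eq_mul, mul_comm]
    have key := interpolation_of_subinterval_bounds (a := a) (b := b) (p := p) (q := q) (r := r)
      (θ := θ) (μ := μ) (K := K) (ε := ε) (F := fun t => ∫ x in a..t, |g m x| ^ r)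
      (G := fun t => ∫ x in a..t, (|g 0 x| ^ q + ε)) (H := fun t => ∫ x in a..t, |g j x| ^ p)
      hab hp0 hq0 hr0 hθ0 hθ1 hμ0 hK.le hε
      -- By the scaling relation the exponent condition reduces to `j ≤ θ * m`.
      (by
        rw [div_le_iff₀ hm0] at hθ
        rw [hscale, mul_sub, mul_one_div]
        linarith)
      (hmono hir fun x => Real.rpow_nonneg (abs_nonneg _) _)
      (hmono hiε fun x => add_nonneg (Real.rpow_nonneg (abs_nonneg _) _) hε.le)
      (hmono hij fun x => Real.rpow_nonneg (abs_nonneg _) _) (hcont hir) (hcont hiε)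
      (fun s hs t ht hst => by
        rw [hincr hiε s hs t ht, hadd s hs t ht]
        exact le_add_of_nonneg_left (intervalIntegral.integral_nonneg hst fun x _ =>
          Real.rpow_nonneg (abs_nonneg _) _))
      (fun s hs t ht hst => by
        rw [hincr hij s hs t ht, hincr hir s hs t ht, hincr hiε s hs t ht, hadd s hs t ht]
        have hs0 : 0 < t - s := sub_pos.2 hst
        have hA' : 0 ≤ ∫ x in s..t, |g m x| ^ r := intervalIntegral.integral_nonneg hst.le
          fun x _ => Real.rpow_nonneg (abs_nonneg _) _
        have hB' : 0 ≤ ∫ x in s..t, |g 0 x| ^ q := intervalIntegral.integral_nonneg hst.le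
          fun x _ => Real.rpow_nonneg (abs_nonneg _) _
        refine (hloc g s t hst (hg.mono hs.1 hst.le ht.2) j hjm p q r hp hq hr
          (hsub hiq s hs t ht) (hsub hir s hs t ht)).trans ?_
        have e1 : (m : ℝ) - j - 1 / r + 1 / p = (1 - θ) * (μ + 1 / q) := by
          rw [hscale, hμ]
          ring
        have e2 : -(j : ℝ) - 1 / q + 1 / p = -(θ * (μ + 1 / q)) := by
          rw [hscale, hμ]
          ring
        rw [e1, e2]
        have : (0 : ℝ) ≤ ε * (t - s) := by positivity
        gcongr
        linarith)
    rw [hadd a haI b (right_mem_Icc.2 hab.le)] at key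
    simp only [intervalIntegral.integral_same, sub_zero] at key
    exact key
  have hlim : ∫ x in a..b, |g j x| ^ p ≤
      2 * (2 * K) ^ p * (A ^ (1 / r * θ * p) * B ^ (1 / q * (1 - θ) * p)) +
        (2 * K * L) ^ p * B ^ (1 / q * p) := by
    -- The limit `ε → 0` is legitimate even if `B = 0`: both exponents on `B + ε * (b - a)` are
    -- positive, because `θ < 1`.
    have hc : Continuous fun ε : ℝ =>
        2 * (2 * K) ^ p * (A ^ (1 / r * θ * p) * (B + ε * (b - a)) ^ (1 / q * (1 - θ) * p)) +
          (2 * K * L) ^ p * (B + ε * (b - a)) ^ (1 / q * p) := by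
      have hbase : Continuous fun ε : ℝ => B + ε * (b - a) := by fun_prop
      exact (continuous_const.mul (continuous_const.mul
        (hbase.rpow_const fun _ => Or.inr (by positivity)))).add
        (continuous_const.mul (hbase.rpow_const fun _ => Or.inr (by positivity)))
    have h1 := (hc.tendsto 0).mono_left (nhdsWithin_le_nhds (s := Ioi 0))
    simp only [zero_mul, add_zero] at h1
    exact ge_of_tendsto h1 (Filter.eventually_of_mem self_mem_nhdsWithin hεbound)
  refine hlim.trans ?_
  set X := (A ^ (1 / r)) ^ θ * (B ^ (1 / q)) ^ (1 - θ) with hX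
  set Y := B ^ (1 / q) with hY
  have hX0 : 0 ≤ X := by positivity
  have hY0 : 0 ≤ Y := by positivity
  have e1 : A ^ (1 / r * θ * p) * B ^ (1 / q * (1 - θ) * p) = X ^ p := by
    rw [hX, hY, Real.mul_rpow (by positivity) (by positivity), ← Real.rpow_mul hA0,
      ← Real.rpow_mul hB0, ← Real.rpow_mul hA0, ← Real.rpow_mul hB0]
  have e2 : B ^ (1 / q * p) = Y ^ p := by rw [hY, Real.rpow_mul hB0]
  have h2 : (2 : ℝ) ≤ 2 ^ p := Real.self_le_rpow_of_one_le (by norm_num) hp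
  rw [e1, e2]
  calc 2 * (2 * K) ^ p * X ^ p + (2 * K * L) ^ p * Y ^ p
      ≤ 2 ^ p * (2 * K) ^ p * X ^ p + (2 * K * L) ^ p * Y ^ p := by gcongr
    _ = (4 * K * X) ^ p + (2 * K * L * Y) ^ p := by
      rw [← Real.mul_rpow (by norm_num) (by positivity), ← Real.mul_rpow (by positivity) hX0,
        ← Real.mul_rpow (by positivity) hY0]
      ring_nf
    _ ≤ (4 * K * X + 2 * K * L * Y) ^ p :=
      Real.add_rpow_le_rpow_add (by positivity) (by positivity) hp
    _ ≤ _ := by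
      refine Real.rpow_le_rpow (by positivity) ?_ hp0.le
      have h3 : 0 ≤ 2 * K * L * X := by positivity
      have h4 : 0 ≤ 4 * K * Y := by positivity
      linarith

theorem eLpNorm_Ioo_eq_intervalIntegral {a b p : ℝ} (hab : a < b) (hp : 1 ≤ p) {f : ℝ → ℝ}
    (hf : MemLp f (ENNReal.ofReal p) (volume.restrict (Ioo a b))) :
    eLpNorm f (ENNReal.ofReal p) (volume.restrict (Ioo a b)) =
      ENNReal.ofReal ((∫ x in a..b, |f x| ^ p) ^ (1 / p)) := by
  have hp0 : 0 < p := by linarith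
  rw [hf.eLpNorm_eq_integral_rpow_norm (by simpa using hp0) ENNReal.ofReal_ne_top,
    ENNReal.toReal_ofReal hp0.le, intervalIntegral.integral_of_le hab.le,
    integral_Ioc_eq_integral_Ioo, one_div]
  rfl

theorem MeasureTheory.MemLp.intervalIntegrable_abs_rpow {a b p : ℝ} (hab : a < b) (hp : 1 ≤ p)
    {f : ℝ → ℝ} (hf : MemLp f (ENNReal.ofReal p) (volume.restrict (Ioo a b))) :
    IntervalIntegrable (fun x => |f x| ^ p) volume a b := by
  have hp0 : 0 < p := by linarith
  have := hf.integrable_norm_rpow (by simpa using hp0) ENNReal.ofReal_ne_top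
  rw [ENNReal.toReal_ofReal hp0.le] at this
  exact (intervalIntegrable_iff_integrableOn_Ioo_of_le hab.le).2 this

theorem theoremA5 (a b : ℝ) (hab : a < b) (p q r : ℝ) (hp : 1 ≤ p) (hq : 1 ≤ q) (hr : 1 ≤ r)
    (j m : ℕ) (hjm : j < m) (θ : ℝ)
    (hscale : 1 / p = (j : ℝ) + θ * (1 / r - (m : ℝ)) + (1 - θ) / q)
    (hθ : (j : ℝ) / (m : ℝ) ≤ θ) (hθ1 : θ < 1) :
    ∃ C : ℝ, 0 < C ∧
      ∀ u : ℝ → ℝ, MemLp u (ENNReal.ofReal q) (volume.restrict (Ioo a b)) →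
        MemSobolev (Ioo a b) m (ENNReal.ofReal r) u →
        ∀ uj um : ℝ → ℝ, HasWeakDerivOn (Ioo a b) j u uj → HasWeakDerivOn (Ioo a b) m u um →
          MemLp uj (ENNReal.ofReal p) (volume.restrict (Ioo a b)) ∧
          eLpNorm uj (ENNReal.ofReal p) (volume.restrict (Ioo a b)) ≤
            ENNReal.ofReal C *
              (eLpNorm um (ENNReal.ofReal r) (volume.restrict (Ioo a b)) ^ θ *
                  eLpNorm u (ENNReal.ofReal q) (volume.restrict (Ioo a b)) ^ (1 - θ) +
                eLpNorm u (ENNReal.ofReal q) (volume.restrict (Ioo a b))) := by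
  obtain ⟨C, hC, hmain⟩ := DerivChainOn.exists_integral_rpow_le_interpolation hab hp hq hr hjm
    hscale hθ hθ1
  refine ⟨C, hC, fun u hu hsob uj um huj hum => ?_⟩
  have hp0 : 0 < p := by linarith
  have hθ0 : 0 ≤ θ := le_trans (by positivity) hθ
  obtain ⟨g, hg, hgv, hg0, hgm⟩ := hsob.exists_derivChainOn hab (by simpa using hr)
  have hu' := hu.ae_eq hg0.symm
  have hcont := hg.continuousOn hab.le hjm
  -- Since `j < m`, the representative `g j` is continuous on the compact interval, hence bounded.
  have hgj : MemLp (g j) (ENNReal.ofReal p) (volume.restrict (Ioo a b)) := by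
    obtain ⟨M, hM⟩ := isCompact_Icc.exists_bound_of_continuousOn hcont
    exact MemLp.of_bound ((hcont.mono Ioo_subset_Icc_self).aestronglyMeasurable measurableSet_Ioo)
      M ((ae_restrict_iff' measurableSet_Ioo).2 (Filter.Eventually.of_forall fun x hx =>
        hM x (Ioo_subset_Icc_self hx)))
  have hujg := hgv j hjm.le uj huj
  refine ⟨hgj.ae_eq hujg.symm, ?_⟩
  rw [eLpNorm_congr_ae hujg, eLpNorm_congr_ae (hgv m le_rfl um hum), eLpNorm_congr_ae hg0.symm,
    eLpNorm_Ioo_eq_intervalIntegral hab hp hgj, eLpNorm_Ioo_eq_intervalIntegral hab hr hgm,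
    eLpNorm_Ioo_eq_intervalIntegral hab hq hu']
  have key := hmain g hg (hu'.intervalIntegrable_abs_rpow hab hq)
    (hgm.intervalIntegrable_abs_rpow hab hr)
  have hA0 : 0 ≤ ∫ x in a..b, |g m x| ^ r := intervalIntegral.integral_nonneg hab.le fun x _ =>
    Real.rpow_nonneg (abs_nonneg _) _
  have hB0 : 0 ≤ ∫ x in a..b, |g 0 x| ^ q := intervalIntegral.integral_nonneg hab.le fun x _ =>
    Real.rpow_nonneg (abs_nonneg _) _
  have hH0 : 0 ≤ ∫ x in a..b, |g j x| ^ p := intervalIntegral.integral_nonneg hab.le fun x _ =>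
    Real.rpow_nonneg (abs_nonneg _) _
  rw [ENNReal.ofReal_rpow_of_nonneg (by positivity) hθ0,
    ENNReal.ofReal_rpow_of_nonneg (by positivity) (by linarith),
    ← ENNReal.ofReal_mul (by positivity), ← ENNReal.ofReal_add (by positivity) (by positivity),
    ← ENNReal.ofReal_mul hC.le]
  refine ENNReal.ofReal_le_ofReal ?_
  refine (Real.rpow_le_rpow hH0 key (by positivity)).trans_eq ?_
  rw [← Real.rpow_mul (by positivity), mul_one_div_cancel hp0.ne', Real.rpow_one]
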